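/- Let $\mathcal T_n$ ($n\ge 1$) be the Tamari lattice whose elements are the Young diagrams contained in the staircase $\delta_{n-1}=(n-1,n-2,\dots,1)$ (rows indexed downward, boxes $(x,y)$ in row $x$ and column $y$, both from $1$). For a diagram $Y$ and a box $B$ that is the last of its row, the prime path of $B$ is the part of the contour of $Y$ (traversed by north and east steps from bottom left to top right, and continued along the top edge) that begins with the right vertical edge of $B$ and stops when it first returns to the line of slope one through its starting point; the $B$-strip is the set of boxes of $Y$ whose right vertical edge lies on the prime path of $B$. The order on $\mathcal T_n$ is the partial order generated by putting $Y'$ above $Y$ whenever $Y'$ arises from $Y$ by removing the $B$-strip of a corner box $B$ of $Y$ (a box that is last in its row and lowest in its column). For $i\ge -1$, let $\mathcal C_i(n)$ be the set of maximal chains $\hat 0=x_0\lessdot x_1\lessdot\dots\lessdot x_l=\hat 1$ of length $l=n+i$ in $\mathcal T_n$. Given such a chain $C$, written downward as $\emptyset=Y_0\gtrdot Y_1\gtrdot\dots\gtrdot Y_l=\delta_{n-1}$, label with $r$ the boxes of $Y_r\setminus Y_{r-1}$ for $1\le r\le l$; let $C(x,y)$ be the label of the box $(x,y)$, and call the set of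 boxes labeled $r$ the $r$-set. The $r$-set is a plus-full-set if it contains a box of row $1$, its box in the row of largest index is $(k,n-k)$ for some $1\le k\le n-1$, and either $k=n-1$ or $C(k+1,n-k-1)<C(k,n-k)$. For $1\le r\le n+i$, let $\mathcal F_i^r(n)$ be the set of all $C\in\mathcal C_i(n)$ whose $r$-set is a plus-full-set and whose $j$-set is not a plus-full-set for every $1\le j<r$. **Corollary.** Let $i\ge -1$, $n\ge 1$ and $0\le r\le n+i$. Then $$\#\mathcal F_i^{r+1}(n+1)=\#\mathcal C_i(n)-\sum_{j=1}^{r}\#\mathcal F_i^{j}(n).$$ -/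

import Mathlib

/-! Boxes of Young diagrams are Mathlib's: row and column indices start at `0`, so the box written
`(x, y)` with one-based indices is the pair `(x - 1, y - 1)` here; rows are indexed downward.
A lattice point `(u, v)` is the point `u` units to the right of the left edge and `v` units below the
top edge of the diagram. The box `(a, b)` has corners `(b, a)`, `(b + 1, a)`, `(b, a + 1)`,
`(b + 1, a + 1)`. -/

/-- The staircase `δ_m = (m, m - 1, …, 1)` (the null diagram if `m = 0`). -/
def staircase (m : ℕ) : YoungDiagram where
  cells := (Finset.range m ×ˢ Finset.range m).filter fun p => p.1 + p.2 < m
  isLowerSet := by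
    intro p q hqp hp
    have h1 : q.1 ≤ p.1 := hqp.1
    have h2 : q.2 ≤ p.2 := hqp.2
    simp only [Finset.coe_filter, Finset.mem_product, Finset.mem_range, Set.mem_ofPred_eq] at hp ⊢
    omega

/-- The lattice point `p` lies on the contour of `Y`: the path of north and east steps that comes up
along the left edge, follows the boundary of `Y`, and leaves to the right along the top edge. On the
horizontal line at depth `v` it occupies the abscissas from the length of the row just below the line
to the length of the row just above it (for `v = 0` there is no row above, and no upper bound).
The Dyck path of length `2n` of a diagram contained in `δ_{n-1}` is the piece of the contour from
`(0, n)` to `(n, 0)`. -/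
def OnContour (Y : YoungDiagram) (p : ℕ × ℕ) : Prop :=
  Y.rowLen p.2 ≤ p.1 ∧ (p.2 = 0 ∨ p.1 ≤ Y.rowLen (p.2 - 1))

/-- `q` is weakly after `p` in the direction of north and east steps. -/
def WeaklyAfter (p q : ℕ × ℕ) : Prop := p.1 ≤ q.1 ∧ q.2 ≤ p.2

/-- The point at which the vertical edge at the end of row `d` begins (its lower end point). -/
def rowStart (Y : YoungDiagram) (d : ℕ) : ℕ × ℕ := (Y.rowLen d, d + 1)

/-- `p` lies on the prime path of row `d`: the part of the contour that begins with the vertical edge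
at the end of row `d` and stops when it first meets again the line of slope one
through its initial point (points `(u, v)` on that line have equal `u + v`). -/
def OnPrimePath (Y : YoungDiagram) (d : ℕ) (p : ℕ × ℕ) : Prop :=
  OnContour Y p ∧ WeaklyAfter (rowStart Y d) p ∧
    ∀ q : ℕ × ℕ, OnContour Y q → WeaklyAfter (rowStart Y d) q → q ≠ rowStart Y d →
      WeaklyAfter q p → q ≠ p → q.1 + q.2 ≠ (rowStart Y d).1 + (rowStart Y d).2

/-- The `B`-strip, for `B` the last box of its row: all boxes of `Y` whose right vertical edge is on
the prime path of (the row of) `B`. -/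
def strip (Y : YoungDiagram) (B : ℕ × ℕ) : Set (ℕ × ℕ) :=
  {p | p ∈ Y ∧ OnPrimePath Y B.1 (p.2 + 1, p.1 + 1) ∧ OnPrimePath Y B.1 (p.2 + 1, p.1)}

/-- `B` is the last box of its row and the lowest box of its column. -/
def IsCornerBox (Y : YoungDiagram) (B : ℕ × ℕ) : Prop :=
  B ∈ Y ∧ (B.1, B.2 + 1) ∉ Y ∧ (B.1 + 1, B.2) ∉ Y

/-- `Y'` is obtained from `Y` by removing the `B`-strip of a corner box `B` of `Y`. -/
def StripRemoval (Y Y' : YoungDiagram) : Prop :=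
  ∃ B, IsCornerBox Y B ∧ ∀ p, p ∈ Y' ↔ p ∈ Y ∧ p ∉ strip Y B

/-- Vertices of the `n`-th Tamari lattice: Young diagrams contained in `δ_{n-1}`. -/
@[ext] structure Tamari (n : ℕ) where
  diagram : YoungDiagram
  le_staircase : diagram ≤ staircase (n - 1)

theorem mem_strip_of_isCornerBox {Y : YoungDiagram} {B : ℕ × ℕ} (h : IsCornerBox Y B) :
    B ∈ strip Y B := by
  obtain ⟨hB, hr, -⟩ := h
  have h1 : B.2 < Y.rowLen B.1 := YoungDiagram.mem_iff_lt_rowLen.1 hB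
  have h2 : ¬ B.2 + 1 < Y.rowLen B.1 := fun h => hr (YoungDiagram.mem_iff_lt_rowLen.2 h)
  have h3 : Y.rowLen B.1 = B.2 + 1 := by omega
  have h4 : Y.rowLen (B.1 + 1) ≤ Y.rowLen B.1 := Y.rowLen_anti _ _ (Nat.le_succ _)
  have h5 : Y.rowLen B.1 ≤ Y.rowLen (B.1 - 1) := Y.rowLen_anti _ _ (Nat.sub_le _ _)
  refine ⟨hB, ⟨⟨?_, ?_⟩, ⟨?_, ?_⟩, ?_⟩, ⟨⟨?_, ?_⟩, ⟨?_, ?_⟩, ?_⟩⟩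
  · simpa using h4.trans h3.le
  · right; simpa using h3.ge
  · exact h3.le
  · exact le_rfl
  · rintro ⟨q1, q2⟩ - ⟨ha, hb⟩ hne ⟨hc, hd⟩ hne'
    exfalso
    simp only [rowStart, ne_eq, Prod.mk.injEq] at *
    omega
  · exact h3.le
  · right; simpa using h3.ge.trans h5
  · exact h3.le
  · exact Nat.le_succ _
  · rintro ⟨q1, q2⟩ - ⟨ha, hb⟩ hne ⟨hc, hd⟩ hne'
    exfalso
    simp only [rowStart, ne_eq, Prod.mk.injEq] at *
    omega

theorem StripRemoval.lt {Y Y' : YoungDiagram} (h : StripRemoval Y Y') : Y' < Y := by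
  obtain ⟨B, hB, h⟩ := h
  refine lt_of_le_of_ne (fun p hp => ((h p).1 hp).1) ?_
  rintro rfl
  exact ((h B).1 hB.1).2 (mem_strip_of_isCornerBox hB)

theorem Tamari.diagram_le_of_reflTransGen {n : ℕ} {x y : Tamari n}
    (h : Relation.ReflTransGen (fun a b : Tamari n => StripRemoval a.diagram b.diagram) x y) :
    y.diagram ≤ x.diagram := by
  induction h with
  | refl => exact le_rfl
  | tail _ hbc ih => exact hbc.lt.le.trans ih

/-- The Tamari order: the partial order generated by strip removals, going up. -/
instance Tamari.instPartialOrder (n : ℕ) : PartialOrder (Tamari n) where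
  le := Relation.ReflTransGen fun a b => StripRemoval a.diagram b.diagram
  le_refl _ := Relation.ReflTransGen.refl
  le_trans _ _ _ := Relation.ReflTransGen.trans
  le_antisymm _ _ hab hba := Tamari.ext
    (le_antisymm (Tamari.diagram_le_of_reflTransGen hba) (Tamari.diagram_le_of_reflTransGen hab))

/-- Saturated chains `x₀ ⋖ x₁ ⋖ ⋯ ⋖ x_l` in the `n`-th Tamari lattice; `length` is `l`. -/
abbrev SatChain (n : ℕ) : Type := RelSeries {p : Tamari n × Tamari n | p.1 ⋖ p.2}

/-- `C_i(n)`: the maximal chains (saturated, from the minimum to the maximum element) of length `n + i`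
in the `n`-th Tamari lattice. -/
def maxChains (i : ℤ) (n : ℕ) : Set (SatChain n) :=
  {C | IsBot C.head ∧ IsTop C.last ∧ (C.length : ℤ) = n + i}

/-- The diagram `Y_r` of a chain written downward from its top element,
`∅ = Y₀ ⋗ Y₁ ⋗ ⋯ ⋗ Y_l` (with `Y_r = Y_l` for `r > l`). -/
def chainDiagram {n : ℕ} (C : SatChain n) (r : ℕ) : YoungDiagram :=
  (C.toFun ⟨C.length - r, by omega⟩).diagram

/-- The tableau `ψ(C)`: a box is labeled by the `r` for which it is removed in the transition from `Y_r`
up to `Y_{r-1}`. (There is exactly one such `r` if the box is in the shape `Y_l` and `Y₀ = ∅`, and then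
`1 ≤ r ≤ l`; the value outside the shape is `0`.) -/
noncomputable def psi {n : ℕ} (C : SatChain n) (p : ℕ × ℕ) : ℕ :=
  sInf {r | p ∈ chainDiagram C r ∧ p ∉ chainDiagram C (r - 1)}

/-- The `r`-set: the boxes of the tableau labeled with `r`. -/
def rSet {n : ℕ} (C : SatChain n) (r : ℕ) : Set (ℕ × ℕ) :=
  {p | p ∈ C.head.diagram ∧ psi C p = r}

/-- `p` is the end-box of `S`: its box in the row of maximum index. -/
def IsEndBox (S : Set (ℕ × ℕ)) (p : ℕ × ℕ) : Prop := p ∈ S ∧ ∀ q ∈ S, q.1 ≤ p.1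

/-- The `r`-set is a full-set with end-box `p`: it begins in the first row and ends in `p`, which
is in the outer diagonal of `δ_{n-1}` (one-based: the boxes `(k, n - k)`, `1 ≤ k ≤ n - 1`). -/
def IsFullSetEndingAt {n : ℕ} (C : SatChain n) (r : ℕ) (p : ℕ × ℕ) : Prop :=
  (∃ q ∈ rSet C r, q.1 = 0) ∧ IsEndBox (rSet C r) p ∧ p.1 + p.2 + 2 = n

/-- The `r`-set is a plus-full-set: a full-set whose end-box is in the first column, or has a southwest
neighbor with a smaller label. -/
def IsPlusFullSet {n : ℕ} (C : SatChain n) (r : ℕ) : Prop :=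
  ∃ p, IsFullSetEndingAt C r p ∧
    (p.2 = 0 ∨ (0 < p.2 ∧ psi C (p.1 + 1, p.2 - 1) < psi C p))

/-- `F_i^r(n)`: the chains in `C_i(n)` whose `r`-set is a plus-full-set and whose `j`-sets, `1 ≤ j < r`,
are not. -/
def firstPlusFull (i : ℤ) (r n : ℕ) : Set (SatChain n) :=
  {C | C ∈ maxChains i n ∧ IsPlusFullSet C r ∧ ∀ j, 1 ≤ j → j < r → ¬ IsPlusFullSet C j}

instance Tamari.instFinite (n : ℕ) : Finite (Tamari n) := by
  refine Finite.of_injective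
    (fun x : Tamari n => (⟨x.diagram.cells, Finset.mem_powerset.2 x.le_staircase⟩ :
      ((staircase (n - 1)).cells.powerset : Finset (Finset (ℕ × ℕ))))) ?_
  intro x y h
  exact Tamari.ext (YoungDiagram.ext (congrArg Subtype.val h))

/-- The set of maximal chains is finite, so that its number of elements is meaningful. -/
theorem maxChains_finite (i : ℤ) (n : ℕ) : (maxChains i n).Finite := by
  have key : (Set.range fun f : Fin ((n + i).toNat + 1) → Tamari n => List.ofFn f).Finite :=
    Set.finite_range _
  refine Set.Finite.of_finite_image (f := RelSeries.toList) (key.subset ?_)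
    RelSeries.toList_injective.injOn
  rintro _ ⟨C, ⟨-, -, hC⟩, rfl⟩
  have hl : C.length = (n + i).toNat := by omega
  rw [← hl]
  exact ⟨C.toFun, rfl⟩

/-!
Measure row `j` of a diagram `Y` by the antidiagonal `Y.rowLen j + j` that it reaches. Removing the
strip of the last box of row `d` removes one box from each row of an interval `e, …, d`, where the rows
`e, …, d - 1` reach less far than row `d` and row `e - 1` reaches farther (`stripRemoval_iff`). Strip
removals are exactly the covers of the Tamari order (`Tamari.covBy_iff_stripRemoval`), so a maximal
chain amounts to a sequence of row lengths growing from `0` to the staircase by such steps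
(`IsGrowth`, `bijOn_rowLens`). In this model, the `r`-set is a plus-full-set if at time `r` the rows
`0, …, d` grow, row `d` becomes full, and row `d + 1` has been full before (`PlusFullAt`).

Consider a chain for `n + 1` whose `(s + 1)`-set is a plus-full-set ending in row `d`. Just before, row
`d` is as long as row `d + 1` and reaches farther than all rows above it. Going back in time, both
properties persist: the rows `d` and `d + 1` always change together, and a strip meeting row `d` meets
all rows above it. After time `s`, both rows are full and no strip passes them. So row `d + 1` can be
deleted together with the `(s + 1)`-set, which leaves a chain for `n` with one step less. Conversely,
given a chain for `n` and a time `s`, the set can be inserted at the row `d` that is the first full row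
at time `s`, and only there (`bijOn_insertSet`). Under this correspondence, plus-full-sets with labels
at most `s` end strictly below row `d` in the large chain and weakly below it in the small one, and
they correspond to each other (`IsGrowth.plusFullAt_insertSet_iff`).

Hence the chains for `n + 1` whose first plus-full-set has label `r + 1` are equinumerous with the chains
for `n` without a plus-full-set among the labels `1, …, r` (`ncard_firstPlusFull_succ`). Sorting the
other chains for `n` by the label of their first plus-full-set gives the formula.
-/

/-! ### Strips in terms of row lengths -/

/-- `StripStep f g`: the sequence `g` of row lengths arises from `f` by adding one box to each of the
rows `e, …, d`, and these boxes form the strip of the last box of row `d`. Measuring a row `j` by the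
antidiagonal `f j + j` that it reaches, this says that the rows `e, …, d - 1` reach less far than row
`d`, while row `e - 1`, if there is one, reaches farther. -/
def StripStep (f g : ℕ → ℕ) : Prop :=
  ∃ e d, e ≤ d ∧ (∀ j, e ≤ j → j ≤ d → g j = f j + 1) ∧ (∀ j, j < e → g j = f j) ∧
    (∀ j, d < j → g j = f j) ∧ (∀ j, e ≤ j → j < d → f j + j < f d + d) ∧
    ∀ k, e = k + 1 → f d + d < f k + k

theorem mem_strip_iff {Y : YoungDiagram} {B : ℕ × ℕ} (hB : IsCornerBox Y B) (p : ℕ × ℕ) :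
    p ∈ strip Y B ↔ p.1 ≤ B.1 ∧ p.2 + 1 = Y.rowLen p.1 ∧
      ∀ j, p.1 ≤ j → j < B.1 → Y.rowLen j + j < Y.rowLen B.1 + B.1 := by
  obtain ⟨d, c⟩ := B
  obtain ⟨a, b⟩ := p
  have anti : ∀ {i j}, i ≤ j → Y.rowLen j ≤ Y.rowLen i := fun h => Y.rowLen_anti _ _ h
  simp only [strip, OnPrimePath, OnContour, WeaklyAfter, rowStart, Set.mem_ofPred_eq,
    YoungDiagram.mem_iff_lt_rowLen, Prod.forall, ne_eq, Prod.mk.injEq]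
  constructor
  · rintro ⟨hY, ⟨-, ⟨-, h1⟩, -⟩, ⟨⟨h2, -⟩, ⟨h3, -⟩, h4⟩⟩
    have had : a ≤ d := by omega
    have hb : b + 1 = Y.rowLen a := by omega
    refine ⟨had, hb, ?_⟩
    by_contra! hcon
    -- the lowest row above `d` reaching at least as far as row `d` carries a return point
    have hfin : ∃ k, ∃ j, j + k = d ∧ a ≤ j ∧ j < d ∧ Y.rowLen d + d ≤ Y.rowLen j + j := by
      obtain ⟨j, h1, h2, h3⟩ := hcon
      exact ⟨d - j, j, by omega, h1, h2, h3⟩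
    classical
    obtain ⟨j, hjk, haj, hjd, hj⟩ := Nat.find_spec hfin
    have hmin : Y.rowLen (j + 1) + (j + 1) ≤ Y.rowLen d + d := by
      rcases Nat.lt_or_ge (j + 1) d with h | h
      · by_contra! hlt
        exact Nat.find_min hfin (m := Nat.find hfin - 1) (by omega)
          ⟨j + 1, by omega, by omega, h, by omega⟩
      · have : j + 1 = d := by omega
        rw [this]
    have hja := anti haj
    exact h4 (Y.rowLen d + d - j) (j + 1) ⟨by omega, Or.inr (by simp; omega)⟩ ⟨by omega, by omega⟩
      (by omega) ⟨by omega, by omega⟩ (by omega) (by omega)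
  · rintro ⟨had, hb, h⟩
    have key : ∀ u v, Y.rowLen v ≤ u → (v = 0 ∨ u ≤ Y.rowLen (v - 1)) → Y.rowLen d ≤ u →
        v ≤ d + 1 → ¬(u = Y.rowLen d ∧ v = d + 1) → u ≤ b + 1 → a ≤ v → ¬(u = b + 1 ∧ v = a) →
        u + v ≠ Y.rowLen d + (d + 1) := by
      intro u v h1 h2 h3 h4 h5 h6 h7 h8
      rcases Nat.eq_or_lt_of_le h7 with rfl | h7
      · omega
      · have h2' : u ≤ Y.rowLen (v - 1) := by omega
        rcases Nat.lt_or_ge (v - 1) d with h9 | h9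
        · have := h (v - 1) (by omega) h9
          omega
        · have : v - 1 = d := by omega
          rw [this] at h2'
          omega
    have h5 := anti had
    have h6 := anti (Nat.le_add_right a 1)
    have h7 := anti (Nat.sub_le a 1)
    refine ⟨by omega, ⟨⟨by omega, Or.inr (by simp; omega)⟩, ⟨by omega, by omega⟩, ?_⟩,
      ⟨⟨by omega, Or.inr (by omega)⟩, ⟨by omega, by omega⟩, ?_⟩⟩
    · rintro u v ⟨h1, h2⟩ ⟨h3, h4⟩ h5 ⟨h6, h7⟩ h8
      exact key u v h1 h2 h3 h4 h5 h6 (by omega) (by omega)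
    · rintro u v ⟨h1, h2⟩ ⟨h3, h4⟩ h5 ⟨h6, h7⟩ h8
      exact key u v h1 h2 h3 h4 h5 h6 h7 h8

theorem rowLen_eq_of_forall {Y : YoungDiagram} {j k : ℕ} (h : ∀ x, (j, x) ∈ Y ↔ x < k) :
    Y.rowLen j = k := by
  have h1 := h (Y.rowLen j)
  have h2 := h k
  rw [YoungDiagram.mem_iff_lt_rowLen] at h1 h2
  omega

theorem ext_rowLen {Y Z : YoungDiagram} (h : ∀ j, Y.rowLen j = Z.rowLen j) : Y = Z := by
  refine YoungDiagram.ext (Finset.ext ?_)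
  rintro ⟨a, b⟩
  rw [YoungDiagram.mem_cells, YoungDiagram.mem_cells, YoungDiagram.mem_iff_lt_rowLen,
    YoungDiagram.mem_iff_lt_rowLen, h]

theorem le_iff_rowLen {Y Z : YoungDiagram} : Y ≤ Z ↔ ∀ j, Y.rowLen j ≤ Z.rowLen j := by
  constructor
  · intro h j
    by_contra! hlt
    exact lt_irrefl _ (YoungDiagram.mem_iff_lt_rowLen.1 (h (YoungDiagram.mem_iff_lt_rowLen.2 hlt)))
  · rintro h ⟨a, b⟩ hp
    exact YoungDiagram.mem_iff_lt_rowLen.2 ((YoungDiagram.mem_iff_lt_rowLen.1 hp).trans_le (h a))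

theorem rowLen_staircase (m j : ℕ) : (staircase m).rowLen j = m - j := by
  refine rowLen_eq_of_forall fun x => ?_
  simp only [staircase, ← YoungDiagram.mem_cells, Finset.mem_filter, Finset.mem_product,
    Finset.mem_range]
  omega

theorem stripRemoval_iff {Y Y' : YoungDiagram} :
    StripRemoval Y Y' ↔ StripStep Y'.rowLen Y.rowLen := by
  constructor
  · rintro ⟨⟨d, c⟩, hB, h⟩
    simp only [mem_strip_iff hB] at h
    obtain ⟨h1, h2, h3⟩ := hB
    simp only [YoungDiagram.mem_iff_lt_rowLen] at h1 h2 h3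
    classical
    have hex : ∃ e, ∀ j, e ≤ j → j < d → Y.rowLen j + j < Y.rowLen d + d :=
      ⟨d, fun j _ _ => by omega⟩
    obtain ⟨e, he, hmin⟩ : ∃ e, (∀ j, e ≤ j → j < d → Y.rowLen j + j < Y.rowLen d + d) ∧
        ∀ e' < e, ¬ ∀ j, e' ≤ j → j < d → Y.rowLen j + j < Y.rowLen d + d :=
      ⟨_, Nat.find_spec hex, fun e' he' => Nat.find_min hex he'⟩
    have hed : e ≤ d := by
      by_contra! hlt
      exact hmin d hlt (fun j _ _ => by omega)
    have hin : ∀ j, e ≤ j → j ≤ d → Y'.rowLen j = Y.rowLen j - 1 := by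
      intro j hj hjd
      refine rowLen_eq_of_forall fun x => ?_
      rw [h, YoungDiagram.mem_iff_lt_rowLen]
      dsimp only
      constructor
      · rintro ⟨h4, h5⟩
        by_contra h6
        exact h5 ⟨hjd, by omega, fun k hk hkd => he k (hj.trans hk) hkd⟩
      · rintro h4
        exact ⟨by omega, fun h5 => by omega⟩
    have hout : ∀ j, j < e ∨ d < j → Y'.rowLen j = Y.rowLen j := by
      intro j hj
      refine rowLen_eq_of_forall fun x => ?_
      rw [h, YoungDiagram.mem_iff_lt_rowLen]
      constructor
      · exact fun h => h.1
      · refine fun h4 => ⟨h4, fun ⟨h5, h6, h7⟩ => ?_⟩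
        exact hmin j (by dsimp only at h5; omega) h7
    have hpos : ∀ j, j ≤ d → 0 < Y.rowLen j := fun j hj => by
      have := Y.rowLen_anti _ _ hj; omega
    refine ⟨e, d, hed, ?_, ?_, ?_, ?_, ?_⟩
    · intro j hj hjd
      have := hin j hj hjd
      have := hpos j hjd
      omega
    · intro j hj
      exact (hout j (Or.inl hj)).symm
    · intro j hj
      exact (hout j (Or.inr hj)).symm
    · intro j hj hjd
      have := he j hj hjd
      have := hin j hj hjd.le
      have := hin d hed le_rfl
      have := hpos j hjd.le
      have := hpos d le_rfl
      omega
    · rintro k rfl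
      have h4 := hout k (by omega)
      have h5 := hin d hed le_rfl
      have h6 := hpos d le_rfl
      by_contra! hle
      refine hmin k (by omega) fun j hj hjd => ?_
      rcases Nat.eq_or_lt_of_le hj with rfl | hj
      · omega
      · exact he j hj hjd
  · rintro ⟨e, d, hed, h1, h2, h3, h4, h5⟩
    have hd := h1 d hed le_rfl
    have hB : IsCornerBox Y (d, Y'.rowLen d) := by
      refine ⟨?_, ?_, ?_⟩ <;> simp only [YoungDiagram.mem_iff_lt_rowLen]
      · omega
      · omega
      · have := h3 (d + 1) (by omega)
        have := Y'.rowLen_anti d (d + 1) (by omega)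
        omega
    refine ⟨_, hB, ?_⟩
    rintro ⟨a, b⟩
    rw [mem_strip_iff hB, YoungDiagram.mem_iff_lt_rowLen, YoungDiagram.mem_iff_lt_rowLen]
    simp only
    constructor
    · intro h
      rcases Nat.lt_or_ge a e with hae | hae
      · have := h2 a hae
        obtain ⟨k, rfl⟩ : ∃ k, e = k + 1 := ⟨e - 1, by omega⟩
        refine ⟨by omega, fun ⟨_, _, h7⟩ => ?_⟩
        have := h7 k (by omega) (by omega)
        have := h5 k rfl
        have := h2 k (by omega)
        omega
      · rcases Nat.lt_or_ge d a with had | had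
        · have := h3 a had
          omega
        · have := h1 a hae had
          omega
    · rintro ⟨h6, h7⟩
      rcases Nat.lt_or_ge a e with hae | hae
      · have := h2 a hae
        omega
      · rcases Nat.lt_or_ge d a with had | had
        · have := h3 a had
          omega
        · have := h1 a hae had
          by_contra h8
          refine h7 ⟨had, by omega, fun j hj hjd => ?_⟩
          have := h1 j (by omega) (by omega)
          have := h4 j (by omega) hjd
          omega

/-! ### Covers and extreme elements of the Tamari order -/

theorem StripStep.le {f g : ℕ → ℕ} (h : StripStep f g) (j : ℕ) : f j ≤ g j := by
  obtain ⟨e, d, -, h1, h2, h3, -⟩ := h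
  rcases Nat.lt_or_ge j e with h | h
  · exact (h2 j h).ge
  · rcases Nat.lt_or_ge d j with h' | h'
    · exact (h3 j h').ge
    · have := h1 j h h'; omega

theorem StripStep.antitone {f g : ℕ → ℕ} (h : StripStep f g) (hf : Antitone f) : Antitone g := by
  refine antitone_nat_of_succ_le fun j => ?_
  obtain ⟨e, d, hed, h1, h2, h3, h4, h5⟩ := h
  have hj := hf (Nat.le_add_right j 1)
  rcases Nat.lt_trichotomy (j + 1) e with h | h | h
  · rw [h2 _ h, h2 j (by omega)]; exact hj
  · have := h5 j h.symm
    have h6 := h1 (j + 1) (by omega) (by omega)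
    have h7 := h2 j (by omega)
    rcases Nat.lt_or_ge (j + 1) d with h' | h'
    · have := h4 (j + 1) (by omega) h'
      omega
    · have : d = j + 1 := by omega
      subst this
      omega
  · rcases Nat.lt_or_ge d (j + 1) with h' | h'
    · have := h3 _ h'
      rcases Nat.lt_or_ge d j with h'' | h''
      · have := h3 _ h''; omega
      · have := h1 j (by omega) h''; omega
    · have := h1 (j + 1) (by omega) h'
      have := h1 j (by omega) (by omega)
      omega

namespace Tamari

variable {n : ℕ}

theorem le_of_stripRemoval {a b : Tamari n} (h : StripRemoval a.diagram b.diagram) : a ≤ b :=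
  Relation.ReflTransGen.single h

theorem lt_of_stripRemoval {a b : Tamari n} (h : StripRemoval a.diagram b.diagram) : a < b := by
  refine lt_of_le_of_ne (le_of_stripRemoval h) ?_
  rintro rfl
  exact lt_irrefl _ h.lt

theorem diagram_anti {a b : Tamari n} (h : a ≤ b) : b.diagram ≤ a.diagram :=
  diagram_le_of_reflTransGen h

theorem exists_stripRemoval_of_lt {a b : Tamari n} (h : a < b) :
    ∃ c : Tamari n, StripRemoval a.diagram c.diagram ∧ c ≤ b := by
  rcases Relation.ReflTransGen.cases_head (show Relation.ReflTransGen _ a b from h.le) with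
    rfl | ⟨c, h1, h2⟩
  · exact absurd h (lt_irrefl _)
  · exact ⟨c, h1, h2⟩

/-- A strip removal does not factor through another one. Let `d` be the lowest row of the strip
`a \ b`. If the first removal `a → c` on the way to `b` is based at a row `d' < d`, then row `d` has
to lose its box in a later removal, which is then based at `d`; but all rows of the strip above row `d`
reach less far than row `d`, so that this removal takes a second box from row `d'`. -/
theorem stripRemoval_eq_of_le {a b c : Tamari n} (hab : StripRemoval a.diagram b.diagram)
    (hac : StripRemoval a.diagram c.diagram) (hcb : c ≤ b) : c = b := by
  rw [stripRemoval_iff] at hab hac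
  obtain ⟨e, d, hed, h1, h2, h3, h4, h5⟩ := hab
  obtain ⟨e', d', hed', k1, k2, k3, k4, k5⟩ := hac
  have hbc := le_iff_rowLen.1 (diagram_anti hcb)
  have hd'e : e ≤ d' := by
    by_contra! h
    have := h2 d' h
    have := k1 d' hed' le_rfl
    have := hbc d'
    omega
  have hd'd : d' ≤ d := by
    by_contra! h
    have := h3 d' h
    have := k1 d' hed' le_rfl
    have := hbc d'
    omega
  have hee : e ≤ e' := by
    by_contra! h
    have := h2 e' h
    have := k1 e' le_rfl hed'
    have := hbc e'
    omega
  rcases Nat.eq_or_lt_of_le hd'd with rfl | hlt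
  · have hee' : e' = e := by
      by_contra hne
      obtain ⟨k, rfl⟩ : ∃ k, e' = k + 1 := ⟨e' - 1, by omega⟩
      have := k5 k rfl
      have := h4 k (by omega) (by omega)
      have := k2 k (by omega)
      have := h1 k (by omega) (by omega)
      have := k1 d' hed' le_rfl
      have := h1 d' hed le_rfl
      omega
    subst hee'
    refine Tamari.ext (ext_rowLen fun j => ?_)
    rcases Nat.lt_or_ge j e' with h | h
    · rw [← h2 j h, k2 j h]
    · rcases Nat.lt_or_ge d' j with h' | h'
      · rw [← h3 j h', k3 j h']
      · have := h1 j h h'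
        have := k1 j h h'
        omega
  · exfalso
    -- row `d` never changes between `c` and `b`
    have inv : ∀ x : Tamari n, c ≤ x → x ≤ b → x.diagram.rowLen d = a.diagram.rowLen d := by
      intro x hcx
      induction (show Relation.ReflTransGen _ c x from hcx) with
      | refl => exact fun _ => (k3 d hlt).symm
      | @tail y z hcy hyz ih =>
        intro hzb
        have hy := ih hcy ((le_of_stripRemoval hyz).trans hzb)
        rw [stripRemoval_iff] at hyz
        obtain ⟨u, v, huv, q1, q2, q3, q4, q5⟩ := hyz
        have hbz := le_iff_rowLen.1 (diagram_anti hzb)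
        have hyc := le_iff_rowLen.1 (diagram_anti (show c ≤ y from hcy))
        rcases Nat.lt_or_ge v d with hv | hv
        · rw [← q3 d hv, hy]
        · have hvd : v = d := by
            by_contra hne
            have := q1 v huv le_rfl
            have := hbz v
            have := h3 v (by omega)
            have := hyc v
            have := k3 v (by omega)
            omega
          subst hvd
          have hd := q1 v huv le_rfl
          have hbd := h1 v hed le_rfl
          have hd' := h1 d' hd'e hd'd
          have kd' := k1 d' hed' le_rfl
          have hbzd' := hbz d'
          have hycd' := hyc d'
          rcases Nat.lt_or_ge d' u with hu | hu
          · obtain ⟨k, rfl⟩ : ∃ k, u = k + 1 := ⟨u - 1, by omega⟩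
            have := q5 k rfl
            have := q2 k (by omega)
            have := h4 k (by omega) (by omega)
            have := h1 k (by omega) (by omega)
            have := hyc k
            rcases Nat.lt_or_ge d' k with hk | hk
            · have := k3 k hk; omega
            · have : k = d' := by omega
              subst this
              omega
          · have := q1 d' hu hlt.le
            omega
    have := inv b hcb le_rfl
    have := h1 d hed le_rfl
    omega

theorem covBy_iff_stripRemoval {a b : Tamari n} : a ⋖ b ↔ StripRemoval a.diagram b.diagram := by
  constructor
  · intro h
    obtain ⟨c, h1, h2⟩ := exists_stripRemoval_of_lt h.lt
    rcases eq_or_lt_of_le h2 with rfl | h3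
    · exact h1
    · exact absurd h3 (h.2 (lt_of_stripRemoval h1))
  · intro h
    refine ⟨lt_of_stripRemoval h, fun c hac hcb => ?_⟩
    obtain ⟨x, h1, h2⟩ := exists_stripRemoval_of_lt hac
    obtain rfl := stripRemoval_eq_of_le h h1 (h2.trans hcb.le)
    exact absurd h2 hcb.not_ge

theorem covBy_iff {a b : Tamari n} : a ⋖ b ↔ StripStep b.diagram.rowLen a.diagram.rowLen :=
  covBy_iff_stripRemoval.trans stripRemoval_iff

end Tamari

/-- The diagram with row lengths `f` (cut off by the staircase). -/
def diagramOf (m : ℕ) (f : ℕ → ℕ) (hf : Antitone f) : YoungDiagram where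
  cells := (staircase m).cells.filter fun p => p.2 < f p.1
  isLowerSet := by
    intro p q hqp hp
    simp only [Finset.coe_filter, Set.mem_ofPred_eq] at hp ⊢
    exact ⟨(staircase m).isLowerSet hqp hp.1, hqp.2.trans_lt (hp.2.trans_le (hf hqp.1))⟩

theorem diagramOf_le (m : ℕ) (f : ℕ → ℕ) (hf : Antitone f) : diagramOf m f hf ≤ staircase m :=
  fun _ hp => (Finset.mem_filter.1 hp).1

theorem rowLen_diagramOf {m : ℕ} {f : ℕ → ℕ} {hf : Antitone f} (h : ∀ j, f j ≤ m - j) (j : ℕ) :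
    (diagramOf m f hf).rowLen j = f j := by
  refine rowLen_eq_of_forall fun x => ?_
  rw [← YoungDiagram.mem_cells, diagramOf, Finset.mem_filter, YoungDiagram.mem_cells,
    YoungDiagram.mem_iff_lt_rowLen, rowLen_staircase]
  have := h j
  dsimp only
  omega

namespace Tamari

variable {m : ℕ}

theorem rowLen_le (a : Tamari (m + 1)) (j : ℕ) : a.diagram.rowLen j ≤ m - j := by
  rw [← rowLen_staircase]
  exact le_iff_rowLen.1 a.le_staircase j

/-- A strip can be added to every diagram other than the staircase: its base is the first row among
those of longest reach that are not yet full. -/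
theorem exists_stripRemoval_to (a : Tamari (m + 1)) (ha : ∃ j, a.diagram.rowLen j ≠ m - j) :
    ∃ b : Tamari (m + 1), StripRemoval b.diagram a.diagram := by
  classical
  set f := a.diagram.rowLen with hfdef
  have hf : Antitone f := fun i j h => a.diagram.rowLen_anti _ _ h
  have hle := a.rowLen_le
  rw [← hfdef] at hle
  have hex : ∃ k, ∃ j, f j + j + k = m ∧ f j < m - j := by
    obtain ⟨j, hj⟩ := ha
    have := hle j
    exact ⟨m - (f j + j), j, by omega, by omega⟩
  have hk := Nat.find_spec hex
  have hkmin := fun k => Nat.find_min hex (m := k)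
  generalize Nat.find hex = k at hk hkmin
  have hd := Nat.find_spec hk
  have hdmin := fun j => Nat.find_min hk (m := j)
  generalize Nat.find hk = d at hd hdmin
  have hfar : ∀ j < d, f j + j < f d + d ∨ f j + j = m := by
    intro j hj
    by_contra! hcon
    have h1 := hle j
    have h2 := hkmin (m - (f j + j))
    have h3 := hdmin j hj
    by_cases h4 : m - (f j + j) < k
    · exact h2 h4 ⟨j, by omega, by omega⟩
    · exact h3 ⟨by omega, by omega⟩
  have hex' : ∃ e, ∀ j, e ≤ j → j < d → f j + j < f d + d := ⟨d, fun j _ _ => by omega⟩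
  have he := Nat.find_spec hex'
  have hemin := fun e => Nat.find_min hex' (m := e)
  generalize Nat.find hex' = e at he hemin
  have hed : e ≤ d := by
    by_contra! hlt
    exact hemin d hlt (fun j _ _ => by omega)
  set g : ℕ → ℕ := fun j => if e ≤ j ∧ j ≤ d then f j + 1 else f j with hg
  have hstep : StripStep f g := by
    refine ⟨e, d, hed, fun j h h' => if_pos ⟨h, h'⟩, fun j h => if_neg (by omega),
      fun j h => if_neg (by omega), he, ?_⟩
    rintro k rfl
    rcases hfar k (by omega) with h | h
    · exfalso
      refine hemin k (by omega) fun j hj hjd => ?_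
      rcases Nat.eq_or_lt_of_le hj with rfl | hj
      · exact h
      · exact he j hj hjd
    · omega
  have hgle : ∀ j, g j ≤ m - j := by
    intro j
    have := hle j
    simp only [hg]
    split_ifs with h
    · rcases Nat.eq_or_lt_of_le h.2 with rfl | h'
      · omega
      · have := he j h.1 h'
        omega
    · exact this
  refine ⟨⟨diagramOf m g (hstep.antitone hf), diagramOf_le _ _ _⟩, ?_⟩
  rw [stripRemoval_iff]
  convert hstep using 1
  exact funext (rowLen_diagramOf (hf := hstep.antitone hf) hgle)

theorem isBot_iff {a : Tamari (m + 1)} : IsBot a ↔ ∀ j, a.diagram.rowLen j = m - j := by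
  constructor
  · intro h j
    have := le_iff_rowLen.1 (diagram_anti (h ⟨staircase m, le_rfl⟩)) j
    rw [rowLen_staircase] at this
    exact le_antisymm (a.rowLen_le j) this
  · intro h b
    obtain ⟨c, hcb, hc⟩ := (Set.toFinite {x : Tamari (m + 1) | x ≤ b}).exists_le_minimal (a := b) (le_refl b)
    have hca : c = a := by
      by_contra hne
      obtain ⟨x, hx⟩ := exists_stripRemoval_to c (by
        by_contra! hall
        exact hne (Tamari.ext (ext_rowLen fun j => (hall j).trans (h j).symm)))
      have hxc := lt_of_stripRemoval hx
      exact hxc.not_ge (hc.2 (hxc.le.trans hcb) hxc.le)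
    exact hca ▸ hcb

/-- A strip can be removed from every nonempty diagram: the one based at the last of the rows that
are as long as the first row. -/
theorem exists_stripRemoval_from (a : Tamari (m + 1)) (ha : ∃ j, a.diagram.rowLen j ≠ 0) :
    ∃ b : Tamari (m + 1), StripRemoval a.diagram b.diagram := by
  classical
  have hg : Antitone a.diagram.rowLen := fun i j h => a.diagram.rowLen_anti _ _ h
  have hle := a.rowLen_le
  set g := a.diagram.rowLen
  have h0 : 0 < g 0 := by
    obtain ⟨j, hj⟩ := ha
    have := hg (Nat.zero_le j)
    omega
  have hex : ∃ k, g k < g 0 := ⟨m, by have := hle m; omega⟩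
  have hk := Nat.find_spec hex
  have hkmin := fun k => Nat.find_min hex (m := k)
  generalize Nat.find hex = k at hk hkmin
  obtain ⟨d, rfl⟩ : ∃ d, k = d + 1 :=
    ⟨k - 1, by have : k ≠ 0 := by rintro rfl; omega
               omega⟩
  have heq : ∀ j ≤ d, g j = g 0 := fun j hj => by
    have := hkmin j (by omega)
    have := hg (Nat.zero_le j)
    omega
  set f : ℕ → ℕ := fun j => if j ≤ d then g j - 1 else g j with hfdef
  have hf : Antitone f := by
    refine antitone_nat_of_succ_le fun j => ?_
    have := hg (Nat.le_add_right j 1)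
    rcases Nat.lt_trichotomy j d with h | rfl | h
    · rw [hfdef]; dsimp only
      rw [if_pos h.le, if_pos (by omega)]
      omega
    · rw [hfdef]; dsimp only
      rw [if_pos le_rfl, if_neg (by omega), heq j le_rfl]
      omega
    · rw [hfdef]; dsimp only
      rw [if_neg (by omega), if_neg (by omega)]
      exact this
  have hfle : ∀ j, f j ≤ m - j := by
    intro j
    have := hle j
    simp only [hfdef]
    split_ifs <;> omega
  refine ⟨⟨diagramOf m f hf, diagramOf_le _ _ _⟩, ?_⟩
  rw [stripRemoval_iff]
  have hrow : (diagramOf m f hf).rowLen = f := funext (rowLen_diagramOf hfle)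
  dsimp only
  rw [hrow]
  refine ⟨0, d, Nat.zero_le _, fun j _ h => ?_, fun j h => by omega, fun j h => ?_,
    fun j _ h => ?_, fun k h => by omega⟩
  · change g j = f j + 1
    simp only [hfdef, if_pos h]
    have := heq j h
    omega
  · simp only [hfdef, if_neg (show ¬ j ≤ d by omega)]
    rfl
  · simp only [hfdef, if_pos h.le, if_pos le_rfl]
    have := heq j h.le
    have := heq d le_rfl
    omega

theorem isTop_iff {a : Tamari (m + 1)} : IsTop a ↔ ∀ j, a.diagram.rowLen j = 0 := by
  constructor
  · intro h j
    have h1 := le_iff_rowLen.1 (diagram_anti (h ⟨⊥, bot_le⟩)) j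
    have h0 : (⊥ : YoungDiagram).rowLen j = 0 := rowLen_eq_of_forall fun x => by simp
    exact Nat.le_zero.1 (h1.trans_eq h0)
  · intro h b
    obtain ⟨c, hcb, hc⟩ := (Set.toFinite {x : Tamari (m + 1) | b ≤ x}).exists_le_maximal (a := b) (le_refl b)
    have hca : c = a := by
      by_contra hne
      obtain ⟨x, hx⟩ := exists_stripRemoval_from c (by
        by_contra! hall
        exact hne (Tamari.ext (ext_rowLen fun j => (hall j).trans (h j).symm)))
      have hxc := lt_of_stripRemoval hx
      exact hxc.not_ge (hc.2 (hcb.trans hxc.le) hxc.le)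
    exact hca ▸ hcb

end Tamari

/-! ### Chains as sequences of row lengths -/

/-- The row lengths `L t` at the times `t = 0, …, l` along a maximal chain of length `l`, written
downward from the empty diagram to the staircase `δ_m`; later times repeat the staircase. -/
def IsGrowth (m l : ℕ) (L : ℕ → ℕ → ℕ) : Prop :=
  (∀ j, L 0 j = 0) ∧ (∀ t, l ≤ t → ∀ j, L t j = m - j) ∧ ∀ t, t < l → StripStep (L t) (L (t + 1))

namespace IsGrowth

variable {m l : ℕ} {L : ℕ → ℕ → ℕ}

theorem le_succ (h : IsGrowth m l L) (t j : ℕ) : L t j ≤ L (t + 1) j := by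
  rcases Nat.lt_or_ge t l with ht | ht
  · exact (h.2.2 t ht).le j
  · rw [h.2.1 t ht, h.2.1 (t + 1) (by omega)]

theorem mono (h : IsGrowth m l L) (j : ℕ) {s t : ℕ} (hst : s ≤ t) : L s j ≤ L t j :=
  monotone_nat_of_le_succ (f := fun t => L t j) (fun t => h.le_succ t j) hst

theorem le (h : IsGrowth m l L) (t j : ℕ) : L t j ≤ m - j := by
  rw [← h.2.1 (max t l) (le_max_right _ _) j]
  exact h.mono j (le_max_left _ _)

theorem antitone (h : IsGrowth m l L) (t : ℕ) : Antitone (L t) := by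
  induction t with
  | zero => intro i j _; rw [h.1, h.1]
  | succ t ih =>
    rcases Nat.lt_or_ge t l with ht | ht
    · exact (h.2.2 t ht).antitone ih
    · intro i j hij
      rw [h.2.1 (t + 1) (by omega), h.2.1 (t + 1) (by omega)]
      omega

end IsGrowth

/-- The row lengths along a chain. -/
def rowLens {n : ℕ} (C : SatChain n) (t j : ℕ) : ℕ := (chainDiagram C t).rowLen j

theorem rowLens_eq {n : ℕ} {C : SatChain n} {t : ℕ} {k : Fin (C.length + 1)}
    (hk : (k : ℕ) = C.length - t) : rowLens C t = (C.toFun k).diagram.rowLen := by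
  have h : k = ⟨C.length - t, by omega⟩ := Fin.ext hk
  rw [h]
  rfl

theorem isGrowth_rowLens {m l : ℕ} {C : SatChain (m + 1)} (h1 : IsBot C.head) (h2 : IsTop C.last)
    (hl : C.length = l) : IsGrowth m l (rowLens C) := by
  subst hl
  rw [Tamari.isBot_iff] at h1
  rw [Tamari.isTop_iff] at h2
  refine ⟨fun j => h2 j, fun t ht j => ?_, fun t ht => ?_⟩
  · rw [← h1 j, rowLens_eq (k := 0) (by simp; omega)]
    rfl
  · have := Tamari.covBy_iff.1 (C.step ⟨C.length - (t + 1), by omega⟩)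
    rwa [← rowLens_eq (t := t) (by simp; omega), ← rowLens_eq (t := t + 1) (by simp)] at this

theorem bijOn_rowLens (i : ℤ) (m l : ℕ) (hl : (l : ℤ) = m + 1 + i) :
    Set.BijOn rowLens (maxChains i (m + 1)) {L | IsGrowth m l L} := by
  have hlen : ∀ C ∈ maxChains i (m + 1), C.length = l := fun C hC => by
    have := hC.2.2
    push_cast at this
    omega
  refine ⟨fun C hC => isGrowth_rowLens hC.1 hC.2.1 (hlen C hC), fun C hC C' hC' h => ?_,
    fun L hL => ?_⟩
  · refine RelSeries.ext ((hlen C hC).trans (hlen C' hC').symm) (funext fun k => ?_)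
    refine Tamari.ext (ext_rowLen fun j => ?_)
    have h' := congrFun h (C.length - k)
    have hk := k.2
    have h1 := hlen C hC
    have h2 := hlen C' hC'
    rw [rowLens_eq (k := k) (by omega),
      rowLens_eq (k := Fin.cast (by rw [h1, h2]) k) (by simp; omega)] at h'
    exact congrFun h' j
  · have hL' : IsGrowth m l L := hL
    let C : SatChain (m + 1) :=
      { length := l
        toFun := fun k => ⟨diagramOf m (L (l - k)) (hL'.antitone _), diagramOf_le _ _ _⟩
        step := fun k => by
          refine Tamari.covBy_iff.2 ?_
          dsimp only
          rw [funext (rowLen_diagramOf (hf := hL'.antitone _) (hL'.le _)),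
            funext (rowLen_diagramOf (hf := hL'.antitone _) (hL'.le _))]
          have := hL'.2.2 (l - (k + 1)) (by omega)
          have hk : l - ((k : ℕ) + 1) + 1 = l - k := by omega
          rwa [hk] at this }
    have hrow : ∀ t, t ≤ l → ∀ j, rowLens C t j = L t j := fun t ht j => by
      simp only [rowLens, chainDiagram, C]
      rw [rowLen_diagramOf (hL'.le _)]
      congr 1
      omega
    have hbot : IsBot C.head := Tamari.isBot_iff.2 fun j => by
      simp only [RelSeries.head, C]
      rw [rowLen_diagramOf (hL'.le _)]
      exact hL'.2.1 _ (by simp) j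
    have htop : IsTop C.last := Tamari.isTop_iff.2 fun j => by
      simp only [RelSeries.last, C]
      rw [rowLen_diagramOf (hL'.le _)]
      simpa using hL'.1 j
    refine ⟨C, ⟨hbot, htop, by push_cast; simp only [C]; omega⟩, ?_⟩
    funext t j
    rcases Nat.le_or_le t l with ht | ht
    · exact hrow t ht j
    · rw [hL'.2.1 t ht, (isGrowth_rowLens hbot htop (l := l) rfl).2.1 t ht]

/-! ### Plus-full-sets in terms of row lengths -/

/-- The `r`-set is a plus-full-set, in terms of row lengths: at time `r` the rows `0, …, d` grow, row
`d` becomes full, and row `d + 1` has been full before. -/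
def PlusFullAt (m : ℕ) (L : ℕ → ℕ → ℕ) (r : ℕ) : Prop :=
  ∃ d, L (r - 1) 0 + 1 = L r 0 ∧ L (r - 1) d + 1 = m - d ∧ L r d = m - d ∧
    L (r - 1) (d + 1) = m - (d + 1)

theorem psi_le_iff {m l : ℕ} {C : SatChain (m + 1)} (h : IsGrowth m l (rowLens C)) {p : ℕ × ℕ}
    (hp : p.1 + p.2 < m) (t : ℕ) : psi C p ≤ t ↔ p.2 < rowLens C t p.1 := by
  have hmem : ∀ s, p ∈ chainDiagram C s ↔ p.2 < rowLens C s p.1 := fun s =>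
    YoungDiagram.mem_iff_lt_rowLen
  have hne : ∃ s, p.2 < rowLens C s p.1 := ⟨l, by rw [h.2.1 l le_rfl]; omega⟩
  have hmono := fun s t (hst : s ≤ t) => h.mono p.1 hst
  have h0 := h.1 p.1
  classical
  have hs := Nat.find_spec hne
  have hmin := fun k => Nat.find_min hne (m := k)
  generalize Nat.find hne = s at hs hmin
  have hpos : 1 ≤ s := by
    by_contra! h1
    obtain rfl : s = 0 := by omega
    omega
  have hset : {r | p ∈ chainDiagram C r ∧ p ∉ chainDiagram C (r - 1)} = {s} := by
    ext r
    simp only [hmem, Set.mem_ofPred_eq, Set.mem_singleton_iff]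
    constructor
    · rintro ⟨h1, h2⟩
      by_contra hne
      rcases Nat.lt_or_gt_of_ne hne with h3 | h3
      · exact hmin r h3 h1
      · have := hmono s (r - 1) (by omega)
        omega
    · rintro rfl
      exact ⟨hs, hmin _ (by omega)⟩
  rw [psi, hset, csInf_singleton]
  constructor
  · intro hst
    exact hs.trans_le (hmono s t hst)
  · intro h1
    by_contra! h2
    exact hmin t h2 h1

theorem mem_rSet_iff {m l : ℕ} {C : SatChain (m + 1)} (hC : IsBot C.head)
    (h : IsGrowth m l (rowLens C)) {r : ℕ} (hr : 1 ≤ r) (p : ℕ × ℕ) :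
    p ∈ rSet C r ↔ rowLens C (r - 1) p.1 ≤ p.2 ∧ p.2 < rowLens C r p.1 := by
  rw [rSet, Set.mem_ofPred_eq, YoungDiagram.mem_iff_lt_rowLen, Tamari.isBot_iff.1 hC]
  have hle := h.le r p.1
  constructor
  · rintro ⟨h1, h2⟩
    have h3 := (psi_le_iff h (p := p) (by omega) r).1 h2.le
    have h4 := psi_le_iff h (p := p) (by omega) (r - 1)
    omega
  · rintro ⟨h1, h2⟩
    have h3 := (psi_le_iff h (p := p) (by omega) r)
    have h4 := psi_le_iff h (p := p) (by omega) (r - 1)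
    omega

theorem isPlusFullSet_iff {m l : ℕ} {C : SatChain (m + 1)} (hC : IsBot C.head)
    (h : IsGrowth m l (rowLens C)) {r : ℕ} (hr : 1 ≤ r) (hrl : r ≤ l) :
    IsPlusFullSet C r ↔ PlusFullAt m (rowLens C) r := by
  have hmem := mem_rSet_iff hC h hr
  have hpsi := fun p (hp : p.1 + p.2 < m) => psi_le_iff h (p := p) hp
  obtain ⟨e, d, hed, h1, h2, h3, h4, h5⟩ := h.2.2 (r - 1) (by omega)
  rw [Nat.sub_add_cancel hr] at h1 h2 h3
  have hle := h.le
  constructor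
  · rintro ⟨⟨x, y⟩, ⟨⟨⟨q1, q2⟩, hq, hq0⟩, ⟨hp, hmax⟩, hdiag⟩, hplus⟩
    rw [hmem] at hq hp
    dsimp only at *
    subst hq0
    have he : e = 0 := by
      by_contra hne
      have := h2 0 (by omega)
      omega
    subst he
    have hxd : x ≤ d := by
      by_contra! hlt
      have := h3 x hlt
      omega
    have hdx : d ≤ x := hmax (d, rowLens C (r - 1) d) (by
      rw [hmem]
      have := h1 d hed le_rfl
      dsimp only
      omega)
    obtain rfl : x = d := by omega
    have hd := h1 x hed le_rfl
    have hd0 := h1 0 le_rfl hed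
    refine ⟨x, by omega, by omega, by omega, ?_⟩
    have hl1 := hle (r - 1) (x + 1)
    rcases hplus with h0 | ⟨h0, hlt⟩
    · omega
    · have h6 := (hpsi (x, y) (by dsimp only; omega) r).2 (by dsimp only; omega)
      have h7 := (hpsi (x + 1, y - 1) (by dsimp only; omega) (r - 1)).1 (by omega)
      dsimp only at h7
      omega
  · rintro ⟨x, p1, p2, p3, p4⟩
    have he : e = 0 := by
      by_contra hne
      have := h2 0 (by omega)
      omega
    subst he
    have hxd : x ≤ d := by
      by_contra! hlt
      have := h3 x hlt
      omega
    have hdx : d ≤ x := by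
      by_contra! hlt
      have := h1 (x + 1) (by omega) (by omega)
      have := hle r (x + 1)
      omega
    obtain rfl : x = d := by omega
    refine ⟨(x, rowLens C (r - 1) x), ⟨⟨(0, rowLens C (r - 1) 0), ?_, rfl⟩, ⟨?_, ?_⟩, ?_⟩, ?_⟩
    · rw [hmem]; dsimp only; omega
    · rw [hmem]; dsimp only; omega
    · rintro ⟨u, v⟩ hq
      rw [hmem] at hq
      dsimp only at *
      by_contra! hlt
      have := h3 u hlt
      omega
    · dsimp only; omega
    · dsimp only
      rcases Nat.eq_zero_or_pos (rowLens C (r - 1) x) with h0 | h0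
      · exact Or.inl h0
      · refine Or.inr ⟨h0, ?_⟩
        have h6 := hpsi (x, rowLens C (r - 1) x) (by dsimp only; omega) (r - 1)
        have h7 := (hpsi (x + 1, rowLens C (r - 1) x - 1) (by dsimp only; omega) (r - 1)).2
          (by dsimp only; omega)
        dsimp only at h6
        omega

/-! ### Duplicating and deleting a row -/

/-- The row lengths with row `d` duplicated. -/
def dupRow (d : ℕ) (f : ℕ → ℕ) (j : ℕ) : ℕ := if j ≤ d then f j else f (j - 1)

/-- The row lengths with row `d` duplicated and a box then added to each of the rows `0, …, d`. -/
def dupRowAdd (d : ℕ) (f : ℕ → ℕ) (j : ℕ) : ℕ := if j ≤ d then f j + 1 else f (j - 1)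

/-- The row lengths with row `d + 1` deleted. -/
def dropRow (d : ℕ) (f : ℕ → ℕ) (j : ℕ) : ℕ := if j ≤ d then f j else f (j + 1)

/-- The row lengths with a box removed from each of the rows `0, …, d` and row `d + 1` deleted. -/
def dropRowSub (d : ℕ) (f : ℕ → ℕ) (j : ℕ) : ℕ := if j ≤ d then f j - 1 else f (j + 1)

section

variable {d j m : ℕ} {f g : ℕ → ℕ}

theorem dupRow_le (h : j ≤ d) : dupRow d f j = f j := if_pos h
theorem dupRow_gt (h : d < j) : dupRow d f j = f (j - 1) := if_neg (by omega)
theorem dupRowAdd_le (h : j ≤ d) : dupRowAdd d f j = f j + 1 := if_pos h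
theorem dupRowAdd_gt (h : d < j) : dupRowAdd d f j = f (j - 1) := if_neg (by omega)
theorem dropRow_le (h : j ≤ d) : dropRow d f j = f j := if_pos h
theorem dropRow_gt (h : d < j) : dropRow d f j = f (j + 1) := if_neg (by omega)
theorem dropRowSub_le (h : j ≤ d) : dropRowSub d f j = f j - 1 := if_pos h
theorem dropRowSub_gt (h : d < j) : dropRowSub d f j = f (j + 1) := if_neg (by omega)

theorem dropRow_dupRow : dropRow d (dupRow d f) = f := by
  funext j
  rcases Nat.lt_or_ge d j with h | h
  · rw [dropRow_gt h, dupRow_gt (by omega), Nat.add_sub_cancel]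
  · rw [dropRow_le h, dupRow_le h]

theorem dropRowSub_dupRowAdd : dropRowSub d (dupRowAdd d f) = f := by
  funext j
  rcases Nat.lt_or_ge d j with h | h
  · rw [dropRowSub_gt h, dupRowAdd_gt (by omega), Nat.add_sub_cancel]
  · rw [dropRowSub_le h, dupRowAdd_le h, Nat.add_sub_cancel]

theorem dupRow_dropRow (h : f d = f (d + 1)) : dupRow d (dropRow d f) = f := by
  funext j
  rcases Nat.lt_or_ge d j with hj | hj
  · rw [dupRow_gt hj]
    obtain ⟨k, rfl⟩ : ∃ k, j = k + 1 := ⟨j - 1, by omega⟩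
    rw [Nat.add_sub_cancel]
    rcases Nat.eq_or_lt_of_le (Nat.le_of_lt_succ hj) with rfl | hk
    · rw [dropRow_le le_rfl, h]
    · rw [dropRow_gt hk]
  · rw [dupRow_le hj, dropRow_le hj]

theorem dupRowAdd_dropRowSub (h : f d = f (d + 1) + 1) (hf : Antitone f) :
    dupRowAdd d (dropRowSub d f) = f := by
  funext j
  rcases Nat.lt_or_ge d j with hj | hj
  · rw [dupRowAdd_gt hj]
    obtain ⟨k, rfl⟩ : ∃ k, j = k + 1 := ⟨j - 1, by omega⟩
    rw [Nat.add_sub_cancel]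
    rcases Nat.eq_or_lt_of_le (Nat.le_of_lt_succ hj) with rfl | hk
    · rw [dropRowSub_le le_rfl, h, Nat.add_sub_cancel]
    · rw [dropRowSub_gt hk]
  · rw [dupRowAdd_le hj, dropRowSub_le hj]
    have := hf hj
    omega

/-- Going back in time, row `d` keeps reaching farther than all rows above it: each strip that meets
row `d` also meets the rows above. -/
theorem StripStep.reach_lt (h : StripStep f g) (hg : ∀ j < d, g j + j < g d + d) :
    ∀ j < d, f j + j < f d + d := by
  obtain ⟨e, D, hed, h1, h2, h3, h4, h5⟩ := h
  intro j hj
  have hgj := hg j hj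
  rcases Nat.lt_or_ge D d with hD | hD
  · have := h3 d hD
    rcases Nat.lt_or_ge j e with hje | hje
    · have := h2 j hje; omega
    · rcases Nat.lt_or_ge D j with hDj | hDj
      · have := h3 j hDj; omega
      · have := h1 j hje hDj; omega
  · rcases Nat.lt_or_ge j e with hje | hje
    · obtain ⟨k, rfl⟩ : ∃ k, e = k + 1 := ⟨e - 1, by omega⟩
      have := h5 k rfl
      rcases Nat.lt_or_ge d (k + 1) with hde | hde
      · have := h2 j hje
        have := h2 d hde
        omega
      · -- row `e - 1` reaches farther than row `D`, hence at least as far as row `d`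
        exfalso
        have h6 := hg k (by omega)
        have h7 := h2 k (by omega)
        have h8 := h1 d hde hD
        rcases Nat.eq_or_lt_of_le hD with rfl | hlt
        · omega
        · have := h4 d hde hlt
          omega
    · have := h1 j hje (by omega)
      have := h1 d (by omega) hD
      omega

/-- A strip that meets row `d` and has all rows above `d` reaching less far begins in row `0`. -/
theorem eq_zero_of_reach_lt {e D : ℕ} (hf : ∀ j < d, f j + j < f d + d) (hed : e ≤ d) (hdD : d ≤ D)
    (h4 : ∀ j, e ≤ j → j < D → f j + j < f D + D) (h5 : ∀ k, e = k + 1 → f D + D < f k + k) :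
    e = 0 := by
  by_contra hne
  obtain ⟨k, rfl⟩ : ∃ k, e = k + 1 := ⟨e - 1, by omega⟩
  have := h5 k rfl
  have := hf k (by omega)
  rcases Nat.eq_or_lt_of_le hdD with rfl | hlt
  · omega
  · have := h4 d hed hlt
    omega

/-- Equal rows `d` and `d + 1` have been equal before. -/
theorem StripStep.row_eq (h : StripStep f g) (hf : Antitone f) (hg : g d = g (d + 1)) :
    f d = f (d + 1) := by
  have hfd := hf (Nat.le_add_right d 1)
  obtain ⟨e, D, hed, h1, h2, h3, h4, h5⟩ := h
  rcases Nat.lt_or_ge (d + 1) e with h6 | h6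
  · rw [← h2 _ h6, ← h2 d (by omega), hg]
  rcases Nat.lt_or_ge D d with h7 | h7
  · rw [← h3 _ h7, ← h3 (d + 1) (by omega), hg]
  rcases Nat.eq_or_lt_of_le h6 with rfl | h8
  · have := h5 d rfl
    have := h1 (d + 1) le_rfl hed
    have := h2 d (by omega)
    rcases Nat.eq_or_lt_of_le hed with rfl | h9
    · omega
    · have := h4 (d + 1) le_rfl h9
      omega
  · have := h1 d (by omega) h7
    rcases Nat.lt_or_ge D (d + 1) with h9 | h9
    · have := h3 (d + 1) h9
      omega
    · have := h1 (d + 1) h6 h9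
      omega

theorem StripStep.dupRow (h : StripStep f g) (hg : ∀ j < d, g j + j < g d + d) :
    StripStep (dupRow d f) (dupRow d g) := by
  have hf := h.reach_lt hg
  obtain ⟨e, D, hed, h1, h2, h3, h4, h5⟩ := h
  rcases Nat.lt_or_ge D d with hD | hD
  · refine ⟨e, D, hed, fun j h h' => ?_, fun j h => ?_, fun j h => ?_, fun j h h' => ?_,
      fun k h => ?_⟩
    · rw [dupRow_le (by omega), dupRow_le (by omega), h1 j h h']
    · rw [dupRow_le (by omega), dupRow_le (by omega), h2 j h]
    · rcases Nat.lt_or_ge d j with hj | hj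
      · rw [dupRow_gt hj, dupRow_gt hj, h3 _ (by omega)]
      · rw [dupRow_le hj, dupRow_le hj, h3 _ h]
    · rw [dupRow_le (by omega), dupRow_le (by omega)]
      exact h4 j h h'
    · rw [dupRow_le (by omega), dupRow_le (by omega)]
      exact h5 k h
  · rcases Nat.lt_or_ge d e with he | he
    · refine ⟨e + 1, D + 1, by omega, fun j h h' => ?_, fun j h => ?_, fun j h => ?_,
        fun j h h' => ?_, fun k h => ?_⟩
      · rw [dupRow_gt (by omega), dupRow_gt (by omega), h1 _ (by omega) (by omega)]
      · rcases Nat.lt_or_ge d j with hj | hj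
        · rw [dupRow_gt hj, dupRow_gt hj, h2 _ (by omega)]
        · rw [dupRow_le hj, dupRow_le hj, h2 _ (by omega)]
      · rw [dupRow_gt (by omega), dupRow_gt (by omega), h3 _ (by omega)]
      · rw [dupRow_gt (by omega), dupRow_gt (by omega), Nat.add_sub_cancel]
        have := h4 (j - 1) (by omega) (by omega)
        omega
      · rw [dupRow_gt (by omega), dupRow_gt (by omega), Nat.add_sub_cancel]
        have := h5 (k - 1) (by omega)
        omega
    · obtain rfl := eq_zero_of_reach_lt hf he hD h4 h5
      refine ⟨0, D + 1, by omega, fun j h h' => ?_, fun j h => by omega, fun j h => ?_,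
        fun j h h' => ?_, fun k h => by omega⟩
      · rcases Nat.lt_or_ge d j with hj | hj
        · rw [dupRow_gt hj, dupRow_gt hj, h1 _ (by omega) (by omega)]
        · rw [dupRow_le hj, dupRow_le hj, h1 _ (by omega) (by omega)]
      · rw [dupRow_gt (by omega), dupRow_gt (by omega), h3 _ (by omega)]
      · rw [dupRow_gt (j := D + 1) (by omega), Nat.add_sub_cancel]
        rcases Nat.lt_or_ge d j with hj | hj
        · rw [dupRow_gt hj]
          have := h4 (j - 1) (by omega) (by omega)
          omega
        · rw [dupRow_le hj]
          rcases Nat.eq_or_lt_of_le (hj.trans hD) with rfl | hlt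
          · omega
          · have := h4 j h hlt
            omega

theorem StripStep.dupRowAdd (h : StripStep f g) (hf : f d = m - d) (hg : ∀ j, g j ≤ m - j) :
    StripStep (dupRowAdd d f) (dupRowAdd d g) := by
  have hle := h.le d
  have hgd := hg d
  obtain ⟨e, D, hed, h1, h2, h3, h4, h5⟩ := h
  rcases Nat.lt_or_ge D d with hD | hD
  · refine ⟨e, D, hed, fun j h h' => ?_, fun j h => ?_, fun j h => ?_, fun j h h' => ?_,
      fun k h => ?_⟩
    · rw [dupRowAdd_le (by omega), dupRowAdd_le (by omega), h1 j h h']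
    · rw [dupRowAdd_le (by omega), dupRowAdd_le (by omega), h2 j h]
    · rcases Nat.lt_or_ge d j with hj | hj
      · rw [dupRowAdd_gt hj, dupRowAdd_gt hj, h3 _ (by omega)]
      · rw [dupRowAdd_le hj, dupRowAdd_le hj, h3 _ h]
    · rw [dupRowAdd_le (by omega), dupRowAdd_le (by omega)]
      have := h4 j h h'
      omega
    · rw [dupRowAdd_le (by omega), dupRowAdd_le (by omega)]
      have := h5 k h
      omega
  · have he : d < e := by
      by_contra! hle
      have := h1 d hle hD
      omega
    refine ⟨e + 1, D + 1, by omega, fun j h h' => ?_, fun j h => ?_, fun j h => ?_,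
      fun j h h' => ?_, fun k h => ?_⟩
    · rw [dupRowAdd_gt (by omega), dupRowAdd_gt (by omega), h1 _ (by omega) (by omega)]
    · rcases Nat.lt_or_ge d j with hj | hj
      · rw [dupRowAdd_gt hj, dupRowAdd_gt hj, h2 _ (by omega)]
      · rw [dupRowAdd_le hj, dupRowAdd_le hj, h2 _ (by omega)]
    · rw [dupRowAdd_gt (by omega), dupRowAdd_gt (by omega), h3 _ (by omega)]
    · rw [dupRowAdd_gt (by omega), dupRowAdd_gt (by omega), Nat.add_sub_cancel]
      have := h4 (j - 1) (by omega) (by omega)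
      omega
    · rw [dupRowAdd_gt (by omega), dupRowAdd_gt (by omega), Nat.add_sub_cancel]
      have := h5 (k - 1) (by omega)
      omega

theorem stripStep_dupRow_dupRowAdd (hf : ∀ j < d, f j + j < f d + d) :
    StripStep (dupRow d f) (dupRowAdd d f) := by
  refine ⟨0, d, Nat.zero_le _, fun j h h' => ?_, fun j h => by omega, fun j h => ?_,
    fun j h h' => ?_, fun k h => by omega⟩
  · rw [dupRow_le h', dupRowAdd_le h']
  · rw [dupRow_gt h, dupRowAdd_gt h]
  · rw [dupRow_le h'.le, dupRow_le le_rfl]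
    exact hf j h'

theorem StripStep.dropRow (h : StripStep f g) (hf : Antitone f) (hg : ∀ j < d, g j + j < g d + d)
    (hgd : g d = g (d + 1)) : StripStep (dropRow d f) (dropRow d g) := by
  have hfd := h.row_eq hf hgd
  have hf' := h.reach_lt hg
  obtain ⟨e, D, hed, h1, h2, h3, h4, h5⟩ := h
  rcases Nat.lt_or_ge D d with hD | hD
  · refine ⟨e, D, hed, fun j h h' => ?_, fun j h => ?_, fun j h => ?_, fun j h h' => ?_,
      fun k h => ?_⟩
    · rw [dropRow_le (by omega), dropRow_le (by omega), h1 j h h']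
    · rw [dropRow_le (by omega), dropRow_le (by omega), h2 j h]
    · rcases Nat.lt_or_ge d j with hj | hj
      · rw [dropRow_gt hj, dropRow_gt hj, h3 _ (by omega)]
      · rw [dropRow_le hj, dropRow_le hj, h3 _ h]
    · rw [dropRow_le (by omega), dropRow_le (by omega)]
      exact h4 j h h'
    · rw [dropRow_le (by omega), dropRow_le (by omega)]
      exact h5 k h
  · -- rows `d` and `d + 1` change together
    obtain ⟨D, rfl⟩ : ∃ D', D = D' + 1 := by
      refine ⟨D - 1, ?_⟩
      by_contra hne
      obtain rfl : D = 0 := by omega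
      obtain rfl : d = 0 := by omega
      have := h1 0 (by omega) le_rfl
      have := h3 (0 + 1) (by omega)
      omega
    have hdD : d ≤ D := by
      by_contra! hlt
      obtain rfl : d = D + 1 := by omega
      have := h1 (D + 1) hed le_rfl
      have := h3 (D + 1 + 1) (by omega)
      omega
    have hne : e ≠ d + 1 := by
      rintro rfl
      have := h1 (d + 1) le_rfl (by omega)
      have := h2 d (by omega)
      omega
    rcases Nat.lt_or_ge d e with he | he
    · obtain ⟨e, rfl⟩ : ∃ e', e = e' + 1 := ⟨e - 1, by omega⟩
      refine ⟨e, D, by omega, fun j h h' => ?_, fun j h => ?_, fun j h => ?_,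
        fun j h h' => ?_, fun k h => ?_⟩
      · rw [dropRow_gt (by omega), dropRow_gt (by omega), h1 _ (by omega) (by omega)]
      · rcases Nat.lt_or_ge d j with hj | hj
        · rw [dropRow_gt hj, dropRow_gt hj, h2 _ (by omega)]
        · rw [dropRow_le hj, dropRow_le hj, h2 _ (by omega)]
      · rw [dropRow_gt (by omega), dropRow_gt (by omega), h3 _ (by omega)]
      · rw [dropRow_gt (by omega), dropRow_gt (by omega)]
        have := h4 (j + 1) (by omega) (by omega)
        omega
      · subst h
        have := h5 (k + 1) rfl
        rw [dropRow_gt (by omega)]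
        rcases Nat.lt_or_ge d k with hk | hk
        · rw [dropRow_gt hk]; omega
        · obtain rfl : k = d := by omega
          rw [dropRow_le le_rfl]; omega
    · obtain rfl := eq_zero_of_reach_lt hf' he hD h4 h5
      refine ⟨0, D, by omega, fun j h h' => ?_, fun j h => by omega, fun j h => ?_,
        fun j h h' => ?_, fun k h => by omega⟩
      · rcases Nat.lt_or_ge d j with hj | hj
        · rw [dropRow_gt hj, dropRow_gt hj, h1 _ (by omega) (by omega)]
        · rw [dropRow_le hj, dropRow_le hj, h1 _ (by omega) (by omega)]
      · rw [dropRow_gt (by omega), dropRow_gt (by omega), h3 _ (by omega)]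
      · rcases Nat.eq_or_lt_of_le hdD with rfl | hlt
        · rw [dropRow_le h'.le, dropRow_le le_rfl]
          exact hf' j h'
        · rw [dropRow_gt hlt]
          rcases Nat.lt_or_ge d j with hj | hj
          · rw [dropRow_gt hj]
            have := h4 (j + 1) (by omega) (by omega)
            omega
          · rw [dropRow_le hj]
            have := h4 (d + 1) (by omega) (by omega)
            rcases Nat.eq_or_lt_of_le hj with rfl | hj'
            · omega
            · have := hf' j hj'
              omega

theorem StripStep.dropRowSub (h : StripStep f g) (hf : Antitone f) (hdm : d ≤ m)
    (hfd : f d = m + 1 - d) (hfd' : f (d + 1) = m - d) (hg : ∀ j, g j ≤ m + 1 - j) :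
    StripStep (dropRowSub d f) (dropRowSub d g) := by
  have hpos : ∀ j ≤ d, 1 ≤ f j := fun j hj => by have := hf hj; omega
  have hgd := hg d
  have hgd' := hg (d + 1)
  obtain ⟨e, D, hed, h1, h2, h3, h4, h5⟩ := h
  rcases Nat.lt_or_ge D d with hD | hD
  · refine ⟨e, D, hed, fun j h h' => ?_, fun j h => ?_, fun j h => ?_, fun j h h' => ?_,
      fun k h => ?_⟩
    · rw [dropRowSub_le (by omega), dropRowSub_le (by omega), h1 j h h']
      have := hpos j (by omega)
      omega
    · rw [dropRowSub_le (by omega), dropRowSub_le (by omega), h2 j h]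
    · rcases Nat.lt_or_ge d j with hj | hj
      · rw [dropRowSub_gt hj, dropRowSub_gt hj, h3 _ (by omega)]
      · rw [dropRowSub_le hj, dropRowSub_le hj, h3 _ h]
    · rw [dropRowSub_le (by omega), dropRowSub_le (by omega)]
      have := h4 j h h'
      have := hpos j (by omega)
      have := hpos D (by omega)
      omega
    · rw [dropRowSub_le (by omega), dropRowSub_le (by omega)]
      have := h5 k h
      have := hpos D (by omega)
      omega
  · -- the full rows `d` and `d + 1` do not change
    have hde : d < e := by
      by_contra! hle
      have := h1 d hle hD
      omega
    have hne : e ≠ d + 1 := by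
      rintro rfl
      have := h1 (d + 1) le_rfl (by omega)
      omega
    obtain ⟨D, rfl⟩ : ∃ D', D = D' + 1 := ⟨D - 1, by omega⟩
    obtain ⟨e, rfl⟩ : ∃ e', e = e' + 1 := ⟨e - 1, by omega⟩
    refine ⟨e, D, by omega, fun j h h' => ?_, fun j h => ?_, fun j h => ?_,
      fun j h h' => ?_, fun k h => ?_⟩
    · rw [dropRowSub_gt (by omega), dropRowSub_gt (by omega), h1 _ (by omega) (by omega)]
    · rcases Nat.lt_or_ge d j with hj | hj
      · rw [dropRowSub_gt hj, dropRowSub_gt hj, h2 _ (by omega)]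
      · rw [dropRowSub_le hj, dropRowSub_le hj, h2 _ (by omega)]
    · rw [dropRowSub_gt (by omega), dropRowSub_gt (by omega), h3 _ (by omega)]
    · rw [dropRowSub_gt (by omega), dropRowSub_gt (by omega)]
      have := h4 (j + 1) (by omega) (by omega)
      omega
    · subst h
      have := h5 (k + 1) rfl
      rw [dropRowSub_gt (by omega)]
      rcases Nat.lt_or_ge d k with hk | hk
      · rw [dropRowSub_gt hk]; omega
      · obtain rfl : k = d := by omega
        rw [dropRowSub_le le_rfl]; omega

end

/-! ### Inserting and deleting a plus-full-set -/

/-- The first row of `f` that is full, that is, as long as in the staircase `δ_m`. -/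
noncomputable def firstFull (m : ℕ) (f : ℕ → ℕ) : ℕ := sInf {j | f j = m - j}

theorem firstFull_spec {m : ℕ} {f : ℕ → ℕ} (hf : ∀ j, f j ≤ m - j) :
    firstFull m f ≤ m ∧ f (firstFull m f) = m - firstFull m f ∧
      ∀ j < firstFull m f, f j + j < m := by
  have hm : m ∈ {j | f j = m - j} := by
    have := hf m
    simp only [Set.mem_ofPred_eq]
    omega
  have hle : firstFull m f ≤ m := Nat.sInf_le hm
  refine ⟨hle, Nat.sInf_mem (s := {j | f j = m - j}) ⟨m, hm⟩, fun j hj => ?_⟩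
  have h1 : ¬ f j = m - j := Nat.notMem_of_lt_sInf (s := {j | f j = m - j}) hj
  have := hf j
  omega

theorem firstFull_eq {m d : ℕ} {f : ℕ → ℕ} (h1 : f d = m - d) (h2 : ∀ j < d, f j + j < m) :
    firstFull m f = d := by
  refine le_antisymm (Nat.sInf_le h1) ?_
  by_contra! hlt
  have h3 : f (firstFull m f) = m - firstFull m f :=
    Nat.sInf_mem (s := {j | f j = m - j}) ⟨d, h1⟩
  have := h2 _ hlt
  omega

/-- Inserts a plus-full-set ending in row `d` as the set of label `s + 1`: row `d` is duplicated up to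
time `s`; then the rows `0, …, d` grow by one box; afterwards, the old sets follow, with labels
increased by one. -/
def insertSet (s d : ℕ) (L : ℕ → ℕ → ℕ) (t : ℕ) : ℕ → ℕ :=
  if t ≤ s then dupRow d (L t) else dupRowAdd d (L (t - 1))

/-- Deletes the set of label `s + 1`, consisting of a box in each of the rows `0, …, d`, together with
row `d + 1`. -/
def deleteSet (s d : ℕ) (M : ℕ → ℕ → ℕ) (t : ℕ) : ℕ → ℕ :=
  if t ≤ s then dropRow d (M t) else dropRowSub d (M (t + 1))

theorem insertSet_le {s d t : ℕ} {L : ℕ → ℕ → ℕ} (h : t ≤ s) :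
    insertSet s d L t = dupRow d (L t) := if_pos h

theorem insertSet_gt {s d t : ℕ} {L : ℕ → ℕ → ℕ} (h : s < t) :
    insertSet s d L t = dupRowAdd d (L (t - 1)) := if_neg (by omega)

theorem deleteSet_le {s d t : ℕ} {M : ℕ → ℕ → ℕ} (h : t ≤ s) :
    deleteSet s d M t = dropRow d (M t) := if_pos h

theorem deleteSet_gt {s d t : ℕ} {M : ℕ → ℕ → ℕ} (h : s < t) :
    deleteSet s d M t = dropRowSub d (M (t + 1)) := if_neg (by omega)

theorem deleteSet_insertSet (s d : ℕ) (L : ℕ → ℕ → ℕ) : deleteSet s d (insertSet s d L) = L := by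
  funext t
  rcases Nat.lt_or_ge s t with h | h
  · rw [deleteSet_gt h, insertSet_gt (by omega), dropRowSub_dupRowAdd, Nat.add_sub_cancel]
  · rw [deleteSet_le h, insertSet_le h, dropRow_dupRow]

namespace IsGrowth

variable {m l s d : ℕ} {L : ℕ → ℕ → ℕ}

theorem reach_lt (h : IsGrowth m l L) (hsl : s ≤ l) (hs : ∀ j < d, L s j + j < L s d + d) {t : ℕ}
    (hts : t ≤ s) : ∀ j < d, L t j + j < L t d + d := by
  induction hts using Nat.decreasingInduction with
  | self => exact hs
  | of_succ t ht ih => exact (h.2.2 t (by omega)).reach_lt ih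

theorem row_eq (h : IsGrowth m l L) (hsl : s ≤ l) (hs : L s d = L s (d + 1)) {t : ℕ}
    (hts : t ≤ s) : L t d = L t (d + 1) := by
  induction hts using Nat.decreasingInduction with
  | self => exact hs
  | of_succ t ht ih => exact (h.2.2 t (by omega)).row_eq (h.antitone t) ih

theorem eq_of_full (h : IsGrowth m l L) (hs : L s d = m - d) {t : ℕ} (hst : s ≤ t) :
    L t d = m - d :=
  le_antisymm (h.le t d) (hs ▸ h.mono d hst)

/-- The growth of the row lengths at a plus-full-set ending in row `d`. -/
theorem exists_of_plusFullAt (h : IsGrowth m l L) (hsl : s < l) (hs : PlusFullAt m L (s + 1)) :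
    ∃ d < m, L s d + 1 = m - d ∧ L s (d + 1) = m - (d + 1) ∧
      (∀ j ≤ d, L (s + 1) j = L s j + 1) ∧ (∀ j, d < j → L (s + 1) j = L s j) ∧
      ∀ j < d, L s j + j < L s d + d := by
  obtain ⟨x, p1, p2, p3, p4⟩ := hs
  rw [Nat.add_sub_cancel] at p1 p2 p4
  obtain ⟨e, d, hed, h1, h2, h3, h4, h5⟩ := h.2.2 s hsl
  have he : e = 0 := by
    by_contra hne
    have := h2 0 (by omega)
    omega
  subst he
  have hxd : x ≤ d := by
    by_contra! hlt
    have := h3 x hlt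
    omega
  have hdx : d ≤ x := by
    by_contra! hlt
    have := h1 (x + 1) (by omega) (by omega)
    have := h.le (s + 1) (x + 1)
    omega
  obtain rfl : x = d := by omega
  exact ⟨x, by omega, p2, p4, fun j => h1 j (Nat.zero_le j), h3, fun j => h4 j (Nat.zero_le j)⟩

theorem insertSet (h : IsGrowth m l L) (hsl : s ≤ l) (hdm : d ≤ m) (hd : L s d = m - d)
    (hlt : ∀ j < d, L s j + j < m) : IsGrowth (m + 1) (l + 1) (insertSet s d L) := by
  have hlt' : ∀ j < d, L s j + j < L s d + d := fun j hj => by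
    have := hlt j hj
    omega
  refine ⟨fun j => ?_, fun t ht j => ?_, fun t ht => ?_⟩
  · rw [insertSet_le (Nat.zero_le s)]
    rcases Nat.lt_or_ge d j with hj | hj
    · rw [dupRow_gt hj, h.1]
    · rw [dupRow_le hj, h.1]
  · rw [insertSet_gt (by omega)]
    rcases Nat.lt_or_ge d j with hj | hj
    · rw [dupRowAdd_gt hj, h.2.1 _ (by omega)]
      omega
    · rw [dupRowAdd_le hj, h.2.1 _ (by omega)]
      omega
  · rcases Nat.lt_trichotomy t s with hts | rfl | hts
    · rw [insertSet_le hts.le, insertSet_le hts]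
      exact (h.2.2 t (by omega)).dupRow (h.reach_lt hsl hlt' hts)
    · rw [insertSet_le le_rfl, insertSet_gt (Nat.lt_add_one t), Nat.add_sub_cancel]
      exact stripStep_dupRow_dupRowAdd hlt'
    · rw [insertSet_gt hts, insertSet_gt (by omega)]
      obtain ⟨u, rfl⟩ : ∃ u, t = u + 1 := ⟨t - 1, by omega⟩
      rw [Nat.add_sub_cancel, Nat.add_sub_cancel]
      exact (h.2.2 u (by omega)).dupRowAdd (h.eq_of_full hd (by omega)) (h.le (u + 1))

theorem plusFullAt_insertSet (hdm : d ≤ m) (hd : L s d = m - d) :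
    PlusFullAt (m + 1) (_root_.insertSet s d L) (s + 1) := by
  refine ⟨d, ?_, ?_, ?_, ?_⟩ <;>
    simp only [Nat.add_sub_cancel, insertSet_le le_rfl, insertSet_gt (Nat.lt_add_one s)]
  · rw [dupRow_le (Nat.zero_le d), dupRowAdd_le (Nat.zero_le d)]
  · rw [dupRow_le le_rfl]
    omega
  · rw [dupRowAdd_le le_rfl]
    omega
  · rw [dupRow_gt (by omega), Nat.add_sub_cancel]
    omega

/-- Up to time `s`, no row above the first row `d` that is full at time `s` can be the end of a
plus-full-set, and the rows below are just renumbered by the duplication of row `d`. -/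
theorem plusFullAt_insertSet_iff (h : IsGrowth m l L) (hlt : ∀ j < d, L s j + j < m) {r : ℕ}
    (hr : 1 ≤ r) (hrs : r ≤ s) :
    PlusFullAt (m + 1) (_root_.insertSet s d L) r ↔ PlusFullAt m L r := by
  have e1 := insertSet_le (d := d) (L := L) hrs
  have e2 := insertSet_le (d := d) (L := L) (show r - 1 ≤ s by omega)
  rw [PlusFullAt, PlusFullAt, e1, e2]
  constructor
  · rintro ⟨x, p1, p2, p3, p4⟩
    have hdx : d < x := by
      by_contra! hle
      rw [_root_.dupRow_le hle] at p3 p2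
      have := h.le r x
      omega
    obtain ⟨x, rfl⟩ : ∃ y, x = y + 1 := ⟨x - 1, by omega⟩
    rw [_root_.dupRow_gt (by omega), Nat.add_sub_cancel] at p2 p3 p4
    rw [_root_.dupRow_le (by omega), _root_.dupRow_le (by omega)] at p1
    exact ⟨x, p1, by omega, by omega, by omega⟩
  · rintro ⟨x, p1, p2, p3, p4⟩
    have hdx : d ≤ x := by
      by_contra! hxd
      have := hlt x hxd
      have := h.mono x hrs
      omega
    refine ⟨x + 1, ?_, ?_, ?_, ?_⟩
    · rwa [_root_.dupRow_le (by omega), _root_.dupRow_le (by omega)]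
    · rw [_root_.dupRow_gt (by omega), Nat.add_sub_cancel]
      omega
    · rw [_root_.dupRow_gt (by omega), Nat.add_sub_cancel]
      omega
    · rw [_root_.dupRow_gt (by omega), Nat.add_sub_cancel]
      omega

end IsGrowth

section

variable {m l s d : ℕ} {M : ℕ → ℕ → ℕ}

theorem deleteSet_ge (h1 : ∀ j ≤ d, M (s + 1) j = M s j + 1) (h2 : ∀ j, d < j → M (s + 1) j = M s j)
    {t : ℕ} (hst : s ≤ t) : deleteSet s d M t = dropRowSub d (M (t + 1)) := by
  rcases Nat.eq_or_lt_of_le hst with rfl | hst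
  · rw [deleteSet_le le_rfl]
    funext j
    rcases Nat.lt_or_ge d j with hj | hj
    · rw [dropRow_gt hj, dropRowSub_gt hj, h2 _ (by omega)]
    · rw [dropRow_le hj, dropRowSub_le hj, h1 j hj, Nat.add_sub_cancel]
  · exact deleteSet_gt hst

theorem IsGrowth.deleteSet (h : IsGrowth (m + 1) (l + 1) M) (hsl : s ≤ l) (hdm : d ≤ m)
    (hd : M s d = m - d) (hd' : M s (d + 1) = m - d) (h1 : ∀ j ≤ d, M (s + 1) j = M s j + 1)
    (h2 : ∀ j, d < j → M (s + 1) j = M s j) (h3 : ∀ j < d, M s j + j < M s d + d) :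
    IsGrowth m l (deleteSet s d M) := by
  refine ⟨fun j => ?_, fun t ht j => ?_, fun t ht => ?_⟩
  · rw [deleteSet_le (Nat.zero_le s)]
    rcases Nat.lt_or_ge d j with hj | hj
    · rw [dropRow_gt hj, h.1]
    · rw [dropRow_le hj, h.1]
  · rw [deleteSet_ge h1 h2 (hsl.trans ht)]
    rcases Nat.lt_or_ge d j with hj | hj
    · rw [dropRowSub_gt hj, h.2.1 _ (by omega)]
      omega
    · rw [dropRowSub_le hj, h.2.1 _ (by omega)]
      omega
  · rcases Nat.lt_or_ge t s with hts | hts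
    · rw [deleteSet_le hts.le, deleteSet_le hts]
      exact (h.2.2 t (by omega)).dropRow (h.antitone t) (h.reach_lt (by omega) h3 hts)
        (h.row_eq (by omega) (hd.trans hd'.symm) hts)
    · rw [deleteSet_ge h1 h2 hts, deleteSet_ge h1 h2 (by omega)]
      have hfull : M (s + 1) d = m + 1 - d := by
        have := h1 d le_rfl
        omega
      have hfull' : M s (d + 1) = m + 1 - (d + 1) := by omega
      refine (h.2.2 (t + 1) (by omega)).dropRowSub (h.antitone _) hdm
        (h.eq_of_full hfull (by omega)) ?_ (h.le _)
      have := h.eq_of_full hfull' (t := t + 1) (by omega)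
      omega

theorem insertSet_deleteSet (h : IsGrowth (m + 1) (l + 1) M) (hsl : s ≤ l) (hdm : d ≤ m)
    (hd : M s d = m - d) (hd' : M s (d + 1) = m - d) (h1 : ∀ j ≤ d, M (s + 1) j = M s j + 1)
    (h2 : ∀ j, d < j → M (s + 1) j = M s j) : insertSet s d (deleteSet s d M) = M := by
  funext t
  rcases Nat.lt_or_ge s t with hst | hst
  · rw [insertSet_gt hst, deleteSet_ge h1 h2 (by omega), Nat.sub_add_cancel (by omega)]
    refine dupRowAdd_dropRowSub ?_ (h.antitone t)
    have hfull : M (s + 1) d = m + 1 - d := by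
      have := h1 d le_rfl
      omega
    have hfull' : M s (d + 1) = m + 1 - (d + 1) := by omega
    have := h.eq_of_full hfull (t := t) hst
    have := h.eq_of_full hfull' (t := t) hst.le
    omega
  · rw [insertSet_le hst, deleteSet_le hst]
    exact dupRow_dropRow (h.row_eq (by omega) (hd.trans hd'.symm) hst)

end

/-- Inserting a plus-full-set with label `s + 1` that ends in the first row that is full at time `s` is
a bijection. -/
theorem bijOn_insertSet {m l s : ℕ} (hsl : s ≤ l) :
    Set.BijOn (fun L => insertSet s (firstFull m (L s)) L)
      {L | IsGrowth m l L ∧ ∀ j, 1 ≤ j → j ≤ s → ¬ PlusFullAt m L j}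
      {M | IsGrowth (m + 1) (l + 1) M ∧ PlusFullAt (m + 1) M (s + 1) ∧
        ∀ j, 1 ≤ j → j < s + 1 → ¬ PlusFullAt (m + 1) M j} := by
  refine Set.InvOn.bijOn (f' := fun M => deleteSet s (firstFull m (M s)) M) ⟨?_, ?_⟩ ?_ ?_
  · rintro L ⟨hL, -⟩
    obtain ⟨-, h2, h3⟩ := firstFull_spec (hL.le s)
    generalize hd : firstFull m (L s) = d at h2 h3
    have hfirst : firstFull m (insertSet s d L s) = d := by
      rw [insertSet_le le_rfl]
      refine firstFull_eq ?_ fun j hj => ?_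
      · rw [dupRow_le le_rfl, h2]
      · rw [dupRow_le hj.le]
        exact h3 j hj
    dsimp only
    rw [hd, hfirst, deleteSet_insertSet]
  · rintro M ⟨hM, hs, -⟩
    obtain ⟨d, hdm, p1, p2, p3, p4, p5⟩ := hM.exists_of_plusFullAt (by omega) hs
    have hd : firstFull m (M s) = d := firstFull_eq (by omega) fun j hj => by
      have := p5 j hj
      omega
    have hd' : firstFull m (deleteSet s d M s) = d := by
      rw [deleteSet_le le_rfl]
      refine firstFull_eq ?_ fun j hj => ?_
      · rw [dropRow_le le_rfl]
        omega
      · rw [dropRow_le hj.le]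
        have := p5 j hj
        omega
    dsimp only
    rw [hd, hd']
    exact insertSet_deleteSet hM hsl (by omega) (by omega) (by omega) p3 p4
  · rintro L ⟨hL, hno⟩
    obtain ⟨h1, h2, h3⟩ := firstFull_spec (hL.le s)
    refine ⟨hL.insertSet hsl h1 h2 h3, IsGrowth.plusFullAt_insertSet h1 h2, fun j hj hjs => ?_⟩
    rw [hL.plusFullAt_insertSet_iff h3 hj (by omega)]
    exact hno j hj (by omega)
  · rintro M ⟨hM, hs, hno⟩
    obtain ⟨d, hdm, p1, p2, p3, p4, p5⟩ := hM.exists_of_plusFullAt (by omega) hs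
    have hd : firstFull m (M s) = d := firstFull_eq (by omega) fun j hj => by
      have := p5 j hj
      omega
    have hL := hM.deleteSet hsl (by omega) (by omega) (by omega) p3 p4 p5
    dsimp only
    rw [hd]
    refine ⟨hL, fun j hj hjs => ?_⟩
    have hlt : ∀ j < d, deleteSet s d M s j + j < m := fun j hj => by
      rw [deleteSet_le le_rfl, dropRow_le hj.le]
      have := p5 j hj
      omega
    rw [← hL.plusFullAt_insertSet_iff hlt hj hjs,
      insertSet_deleteSet hM hsl (by omega) (by omega) (by omega) p3 p4]
    exact hno j hj (by omega)

/-! ### Counting -/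

theorem Set.BijOn.sep {α β : Type*} {f : α → β} {s : Set α} {t : Set β} (h : Set.BijOn f s t)
    {p : α → Prop} {q : β → Prop} (hpq : ∀ a ∈ s, p a ↔ q (f a)) :
    Set.BijOn f {a | a ∈ s ∧ p a} {b | b ∈ t ∧ q b} := by
  refine ⟨fun a ha => ⟨h.mapsTo ha.1, (hpq a ha.1).1 ha.2⟩, h.injOn.mono fun a ha => ha.1, ?_⟩
  rintro b ⟨hb, hq⟩
  obtain ⟨a, ha, rfl⟩ := h.surjOn hb
  exact ⟨a, ⟨ha, (hpq a ha).2 hq⟩, rfl⟩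

/-- The chains without a plus-full-set among the labels `1, …, r`. -/
def noPlusFull (i : ℤ) (r n : ℕ) : Set (SatChain n) :=
  {C | C ∈ maxChains i n ∧ ∀ j, 1 ≤ j → j ≤ r → ¬ IsPlusFullSet C j}

theorem isPlusFullSet_iff_of_mem {i : ℤ} {m l : ℕ} (hl : (l : ℤ) = m + 1 + i)
    {C : SatChain (m + 1)} (hC : C ∈ maxChains i (m + 1)) {r : ℕ} (hr : 1 ≤ r) (hrl : r ≤ l) :
    IsPlusFullSet C r ↔ PlusFullAt m (rowLens C) r :=
  isPlusFullSet_iff hC.1 ((bijOn_rowLens i m l hl).mapsTo hC) hr hrl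

theorem ncard_firstPlusFull_succ {i : ℤ} {m l r : ℕ} (hl : (l : ℤ) = m + 1 + i) (hr : r ≤ l) :
    (firstPlusFull i (r + 1) (m + 1 + 1)).ncard = (noPlusFull i r (m + 1)).ncard := by
  have hl' : ((l + 1 : ℕ) : ℤ) = (m + 1 : ℕ) + 1 + i := by push_cast; omega
  have b1 := (bijOn_rowLens i m l hl).sep
    (p := fun C => ∀ j, 1 ≤ j → j ≤ r → ¬ IsPlusFullSet C j)
    (q := fun L => ∀ j, 1 ≤ j → j ≤ r → ¬ PlusFullAt m L j) fun C hC =>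
      forall_congr' fun j => forall_congr' fun hj => forall_congr' fun hjr =>
        not_congr (isPlusFullSet_iff_of_mem hl hC hj (hjr.trans hr))
  have b2 := (bijOn_rowLens i (m + 1) (l + 1) hl').sep
    (p := fun C => IsPlusFullSet C (r + 1) ∧ ∀ j, 1 ≤ j → j < r + 1 → ¬ IsPlusFullSet C j)
    (q := fun L => PlusFullAt (m + 1) L (r + 1) ∧
      ∀ j, 1 ≤ j → j < r + 1 → ¬ PlusFullAt (m + 1) L j) fun C hC =>
      and_congr (isPlusFullSet_iff_of_mem hl' hC (by omega) (by omega)) <|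
      forall_congr' fun j => forall_congr' fun hj => forall_congr' fun hjr =>
        not_congr (isPlusFullSet_iff_of_mem hl' hC hj (by omega))
  exact b2.ncard_eq.trans ((bijOn_insertSet hr).ncard_eq.symm.trans b1.ncard_eq.symm)

theorem ncard_noPlusFull_add (i : ℤ) (n r : ℕ) :
    (noPlusFull i r n).ncard + ∑ j ∈ Finset.Icc 1 r, (firstPlusFull i j n).ncard =
      (maxChains i n).ncard := by
  induction r with
  | zero =>
    have h : noPlusFull i 0 n = maxChains i n := by
      ext C
      exact ⟨fun h => h.1, fun h => ⟨h, fun j h1 h2 => by omega⟩⟩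
    simp [h]
  | succ r ih =>
    have hunion : noPlusFull i r n = noPlusFull i (r + 1) n ∪ firstPlusFull i (r + 1) n := by
      ext C
      constructor
      · rintro ⟨h1, h2⟩
        by_cases h3 : IsPlusFullSet C (r + 1)
        · exact Or.inr ⟨h1, h3, fun j hj hjr => h2 j hj (by omega)⟩
        · refine Or.inl ⟨h1, fun j hj hjr => ?_⟩
          rcases Nat.eq_or_lt_of_le hjr with rfl | h
          · exact h3
          · exact h2 j hj (by omega)
      · rintro (⟨h1, h2⟩ | ⟨h1, -, h2⟩)
        · exact ⟨h1, fun j hj hjr => h2 j hj (by omega)⟩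
        · exact ⟨h1, fun j hj hjr => h2 j hj (by omega)⟩
    have hdisj : Disjoint (noPlusFull i (r + 1) n) (firstPlusFull i (r + 1) n) :=
      Set.disjoint_left.2 fun C h1 h2 => h1.2 (r + 1) (by omega) le_rfl h2.2.1
    rw [hunion, Set.ncard_union_eq hdisj ((maxChains_finite i n).subset fun C hC => hC.1)
      ((maxChains_finite i n).subset fun C hC => hC.1)] at ih
    rw [Finset.sum_Icc_succ_top (by omega)]
    omega

theorem corollary4p10 (i : ℤ) (hi : -1 ≤ i) (n : ℕ) (hn : 1 ≤ n) (r : ℕ) (hr : (r : ℤ) ≤ n + i) :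
    ((firstPlusFull i (r + 1) (n + 1)).ncard : ℤ) =
      ((maxChains i n).ncard : ℤ) - ∑ j ∈ Finset.Icc 1 r, ((firstPlusFull i j n).ncard : ℤ) := by
  obtain ⟨m, rfl⟩ : ∃ m, n = m + 1 := ⟨n - 1, by omega⟩
  have hl : (((m + 1 + i).toNat : ℕ) : ℤ) = m + 1 + i := by omega
  rw [ncard_firstPlusFull_succ hl (by push_cast at hr; omega), ← ncard_noPlusFull_add i (m + 1) r]
  push_cast
  ring
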